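/- Let $G$ be an abelian group whose cardinality is at most the cardinality $\mathfrak c = 2^{\aleph_0}$ of the continuum, and let $H$ be a subgroup of $G$. For every separable metrizable topology $\tau_H$ on $H$ that makes $H$ a topological group, there is a separable metrizable topology $\tau_G$ on $G$ that makes $G$ a topological group and extends $\tau_H$, that is, the subspace topology induced by $\tau_G$ on $H$ is equal to $\tau_H$. -/

import Mathlib

open Filter Topology TopologicalSpace Cardinal TensorProduct nonZeroDivisors

universe u

/-! Embed `H` topologically in a separable metrizable divisible group `D`. Divisible groups are
injective, so the embedding extends to a homomorphism `F : G → D`, usually not injective. To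
separate the remaining points, embed `G ⧸ H` algebraically, by `q`, in the Polish group `ℝ × ∏ₚ
𝕋^ℕ`. The map `(F, q ∘ π)`, with `π : G → G ⧸ H` the projection, is then injective and induces the
topology on `G`; on `H` its second coordinate vanishes, so `τH` is recovered. -/

/-- A metrizable topological abelian group has a compatible translation-invariant norm. -/
theorem exists_addGroupNorm_of_metrizable (H : Type*) [AddCommGroup H] [τ : TopologicalSpace H]
    [IsTopologicalAddGroup H] [MetrizableSpace H] :
    ∃ N : AddGroupNorm H,
      N.toNormedAddCommGroup.toMetricSpace.toUniformSpace.toTopologicalSpace = τ := by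
  let : UniformSpace H := IsTopologicalAddGroup.rightUniformSpace H
  have : IsUniformAddGroup H := isUniformAddGroup_of_addCommGroup
  have : (uniformity H).IsCountablyGenerated := IsUniformAddGroup.uniformity_countably_generated
  let : MetricSpace H := UniformSpace.metricSpace H
  -- The metric need not be invariant: the supremum over translates makes it so, and truncation at 1
  -- keeps the supremum finite.
  have bdd (x : H) : BddAbove (Set.range fun g : H => min 1 (dist (x + g) g)) :=
    ⟨1, by rintro _ ⟨g, rfl⟩; exact min_le_left _ _⟩
  have le (x g : H) : min 1 (dist (x + g) g) ≤ ⨆ g : H, min 1 (dist (x + g) g) :=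
    le_ciSup (bdd x) g
  have neg_le (x : H) : (⨆ g : H, min 1 (dist (-x + g) g)) ≤ ⨆ g : H, min 1 (dist (x + g) g) := by
    refine ciSup_le fun g => ?_
    have := le x (-x + g)
    rwa [add_neg_cancel_left, dist_comm] at this
  let N : AddGroupNorm H :=
    { toFun := fun x => ⨆ g : H, min 1 (dist (x + g) g)
      map_zero' := by simp
      add_le' := fun x y => by
        refine ciSup_le fun g => ?_
        have h1 := le x (y + g)
        have h2 := le y g
        have h3 := dist_triangle (x + (y + g)) (y + g) g
        rw [add_assoc]
        refine le_trans ?_ (add_le_add h1 h2)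
        have h4 : 0 ≤ dist (x + (y + g)) (y + g) := dist_nonneg
        have h5 : 0 ≤ dist (y + g) g := dist_nonneg
        rcases min_cases 1 (dist (x + (y + g)) (y + g)) with h | h <;>
        rcases min_cases 1 (dist (y + g) g) with h' | h' <;>
        rcases min_cases 1 (dist (x + (y + g)) g) with h'' | h'' <;> linarith
      neg' := fun x => le_antisymm (neg_le x) (by simpa using neg_le (-x))
      eq_zero_of_map_eq_zero' := fun x hx => by
        have h := (le x 0).trans_eq hx
        rw [add_zero] at h
        have : dist x 0 ≤ 0 := by
          rcases min_le_iff.1 h with h | h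
          · linarith
          · exact h
        exact dist_le_zero.1 this }
  refine ⟨N, ?_⟩
  refine IsTopologicalAddGroup.ext
    (@SeminormedAddCommGroup.toIsTopologicalAddGroup H
      N.toNormedAddCommGroup.toSeminormedAddCommGroup) inferInstance ?_
  have hb := @Metric.nhds_basis_ball H N.toNormedAddCommGroup.toPseudoMetricSpace 0
  have mem (ε : ℝ) (x : H) :
      x ∈ @Metric.ball H N.toNormedAddCommGroup.toPseudoMetricSpace 0 ε ↔
        (⨆ g : H, min 1 (dist (x + g) g)) < ε := by
    have : @dist H N.toNormedAddCommGroup.toPseudoMetricSpace.toDist x 0 =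
        @norm H N.toNormedAddCommGroup.toNorm x :=
      @dist_zero_right H N.toNormedAddCommGroup.toSeminormedAddCommGroup.toSeminormedAddGroup x
    rw [@Metric.mem_ball, this]
    rfl
  refine hb.ext Metric.nhds_basis_ball (fun ε hε => ?_) (fun ε hε => ?_)
  -- The uniformity comes from neighbourhoods of 0, so the bound is uniform in `g`.
  · have hu : ∀ᶠ x : H in 𝓝 0, ∀ g, dist (x + g) g < ε / 2 := by
      have := Metric.dist_mem_uniformity (α := H) (half_pos hε)
      rw [uniformity_eq_comap_nhds_zero, mem_comap] at this
      obtain ⟨t, ht, hts⟩ := this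
      filter_upwards [ht] with x hx g
      have : (g, x + g) ∈ {p : H × H | dist p.1 p.2 < ε / 2} := hts (by simpa using hx)
      rw [dist_comm]
      exact this
    obtain ⟨δ, hδ, hsub⟩ := Metric.eventually_nhds_iff_ball.1 hu
    refine ⟨δ, hδ, fun x hx => (mem ε x).2 ?_⟩
    have : (⨆ g : H, min 1 (dist (x + g) g)) ≤ ε / 2 :=
      ciSup_le fun g => (min_le_right _ _).trans (hsub x hx g).le
    linarith
  · refine ⟨min 1 ε, by positivity, fun x hx => ?_⟩
    have h := (le x 0).trans_lt ((mem _ x).1 hx)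
    rw [add_zero] at h
    rw [Metric.mem_ball]
    rcases min_lt_iff.1 h with h | h
    · exact absurd (min_le_left 1 ε) (not_le.2 h)
    · exact h.trans_le (min_le_right _ _)

/-- The space `ℓ¹` over a countable index type is separable. -/
theorem separableSpace_lp_one (ι : Type*) [Countable ι] :
    SeparableSpace (lp (fun _ : ι => ℝ) 1) := by
  classical
  let s : Set (lp (fun _ : ι => ℝ) 1) := Set.range fun i => lp.single 1 i (1 : ℝ)
  have hs : IsSeparable (closure (Submodule.span ℝ s : Set (lp (fun _ : ι => ℝ) 1))) :=
    ((Set.countable_range _).isSeparable.span (R := ℝ)).closure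
  have htop : closure (Submodule.span ℝ s : Set (lp (fun _ : ι => ℝ) 1)) = Set.univ := by
    refine Set.eq_univ_of_forall fun f => ?_
    refine mem_closure_of_tendsto (lp.hasSum_single ENNReal.one_ne_top f)
      (Eventually.of_forall fun t => ?_)
    refine Submodule.sum_mem _ fun i _ => ?_
    have : lp.single (E := fun _ : ι => ℝ) 1 i (f i) = f i • lp.single 1 i (1 : ℝ) := by
      rw [← lp.single_smul, smul_eq_mul, mul_one]
    rw [this]
    exact Submodule.smul_mem _ _ (Submodule.subset_span ⟨i, rfl⟩)
  rw [htop] at hs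
  exact isSeparable_univ_iff.1 hs

/-- A divisible abelian group satisfies Baer's criterion over `ℤ`. -/
theorem Module.Baer.of_smul_surjective (A : Type*) [AddCommGroup A]
    (h : ∀ n : ℤ, n ≠ 0 → Function.Surjective fun a : A => n • a) : Module.Baer ℤ A := by
  let : DivisibleBy A ℤ := divisibleByOfSMulRightSurj A ℤ fun {n} hn => h n hn
  exact Module.Baer.of_divisible A

theorem Module.Baer.of_module_rat_quotient (E : Type*) [AddCommGroup E] [Module ℚ E]
    (S : AddSubgroup E) : Module.Baer ℤ (E ⧸ S) := by
  refine .of_smul_surjective _ fun n hn a => ?_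
  obtain ⟨x, rfl⟩ := QuotientAddGroup.mk_surjective a
  refine ⟨(((n : ℚ)⁻¹ • x : E) : E ⧸ S), ?_⟩
  change n • (((n : ℚ)⁻¹ • x : E) : E ⧸ S) = x
  rw [← QuotientAddGroup.mk_zsmul, ← Int.cast_smul_eq_zsmul ℚ, smul_smul,
    mul_inv_cancel₀ (by exact_mod_cast hn), one_smul]

/-- A countable normed abelian group embeds isometrically into a complete separable divisible
one: the quotient of a weighted `ℓ¹` space by the closure of the relations of the group. -/
theorem exists_isometry_divisible_of_countable (K : Type u) [NormedAddCommGroup K] [Countable K] :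
    ∃ (D : Type u) (_ : NormedAddCommGroup D) (f : K →+ D),
      CompleteSpace D ∧ SeparableSpace D ∧ Module.Baer ℤ D ∧ ∀ x, ‖f x‖ = ‖x‖ := by
  classical
  let E := lp (fun _ : K => ℝ) 1
  -- With weights `‖k‖`, the norm of `j m` is `∑ |m k| ‖k‖`, which dominates `‖π m‖`.
  let j : (K →₀ ℤ) →ₗ[ℤ] E := Finsupp.linearCombination ℤ fun k => lp.single 1 k ‖k‖
  let π : (K →₀ ℤ) →ₗ[ℤ] K := Finsupp.linearCombination ℤ id
  let R : AddSubgroup E := (LinearMap.ker π).toAddSubgroup.map j.toAddMonoidHom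
  let S := R.topologicalClosure
  have : IsClosed (S : Set E) := R.isClosed_topologicalClosure
  have := separableSpace_lp_one K
  have jcoe (m : K →₀ ℤ) (k : K) : j m k = m k * ‖k‖ := by
    induction m using Finsupp.induction_linear with
    | zero => simp
    | add a b ha hb =>
      rw [map_add, lp.coeFn_add, Pi.add_apply, ha, hb, Finsupp.add_apply, Int.cast_add, add_mul]
    | single a n =>
      have : j (Finsupp.single a n) = lp.single 1 a (n • ‖a‖) := by
        simp only [j, Finsupp.linearCombination_single]
        exact (map_zsmul (lp.singleAddMonoidHom (E := fun _ : K => ℝ) 1 a) n ‖a‖).symm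
      rw [this, lp.single_apply, Pi.single_apply, Finsupp.single_apply]
      by_cases h : k = a
      · simp [h]
      · simp [h, Ne.symm h]
  have norm_le (m : K →₀ ℤ) : ‖π m‖ ≤ ‖j m‖ := by
    have h1 := lp.sum_rpow_le_norm_rpow (p := 1) (by simp) (j m) m.support
    simp only [ENNReal.toReal_one, Real.rpow_one] at h1
    refine le_trans ?_ h1
    simp only [π, Finsupp.linearCombination_apply, Finsupp.sum]
    refine (norm_sum_le _ _).trans (Finset.sum_le_sum fun k _ => ?_)
    rw [jcoe, norm_mul, norm_norm, Int.norm_cast_real]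
    exact norm_zsmul_le _ _
  let f : K →+ E ⧸ S := AddMonoidHom.mk' (fun k => (j (Finsupp.single k 1) : E ⧸ S)) fun a b => by
    rw [← QuotientAddGroup.mk_add, QuotientAddGroup.eq]
    refine R.le_topologicalClosure ⟨-Finsupp.single (a + b) 1 + (.single a 1 + .single b 1), ?_, ?_⟩
    · simp [π]
    · simp
  refine ⟨E ⧸ S, inferInstance, f, inferInstance, inferInstance,
    Module.Baer.of_module_rat_quotient E S, fun x => le_antisymm ?_ ?_⟩
  · refine (QuotientAddGroup.norm_mk_le_norm).trans ?_
    simp only [j, Finsupp.linearCombination_single, one_smul]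
    rw [lp.norm_single zero_lt_one, norm_norm]
  -- Subtracting a relation leaves the image under `π` unchanged, so `norm_le` bounds the distance
  -- to `R` below.
  · change ‖x‖ ≤ ‖((j (Finsupp.single x 1) : E) : E ⧸ S)‖
    rw [QuotientAddGroup.norm_mk, AddSubgroup.topologicalClosure_coe, Metric.infDist_closure]
    refine (Metric.le_infDist ⟨0, R.zero_mem⟩).2 ?_
    rintro _ ⟨m, hm, rfl⟩
    have h := norm_le (Finsupp.single x 1 - m)
    have hm' : π m = 0 := hm
    rw [map_sub, hm', sub_zero, map_sub] at h
    rw [dist_eq_norm]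
    simpa [π] using h

/-- A separable normed abelian group embeds isometrically into a separable divisible one. -/
theorem exists_isometry_divisible (H : Type u) [NormedAddCommGroup H] [SeparableSpace H] :
    ∃ (D : Type u) (_ : NormedAddCommGroup D) (f : H →+ D),
      SeparableSpace D ∧ Module.Baer ℤ D ∧ Isometry f := by
  let K : AddSubgroup H := (Finsupp.linearCombination ℤ (denseSeq H)).toAddMonoidHom.range
  have hK : Dense (K : Set H) := (denseRange_denseSeq H).mono <| by
    rintro _ ⟨n, rfl⟩
    exact ⟨Finsupp.single n 1, by simp⟩
  have : Countable K := Set.countable_range _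
  obtain ⟨D, _, f, _, hsep, hdiv, hf⟩ := exists_isometry_divisible_of_countable K
  have hfu : UniformContinuous f := (AddMonoidHomClass.isometry_of_norm f hf).uniformContinuous
  have hc : Continuous (hK.extend f) := (hK.uniformContinuous_extend hfu).continuous
  have he (x : K) : hK.extend f x = f x := hK.extend_of_ind hfu x
  have hdr : DenseRange ((↑) : K → H) := hK.denseRange_val
  let F : H →+ D := AddMonoidHom.mk' (hK.extend f) fun a b => by
    refine hdr.induction_on₂ (p := fun a b => hK.extend f (a + b) = hK.extend f a + hK.extend f b)
      (isClosed_eq (by fun_prop) (by fun_prop)) (fun x y => ?_) a b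
    rw [← AddSubgroup.coe_add, he, he, he, map_add]
  refine ⟨D, _, F, hsep, hdiv, AddMonoidHomClass.isometry_of_norm F fun x => ?_⟩
  refine hdr.induction_on (p := fun x => ‖hK.extend f x‖ = ‖x‖) x
    (isClosed_eq (by fun_prop) (by fun_prop)) fun x => ?_
  rw [he, hf]
  rfl

/-- A homomorphism to `ℝ` whose kernel is the torsion subgroup. -/
theorem exists_addMonoidHom_real_of_card_le (A : Type*) [AddCommGroup A] (hA : #A ≤ 𝔠) :
    ∃ f : A →+ ℝ, ∀ x, f x = 0 → ∃ n : ℕ, n ≠ 0 ∧ n • x = 0 := by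
  let i : A →ₗ[ℤ] ℚ ⊗[ℤ] A := TensorProduct.mk ℤ ℚ A 1
  have : IsLocalizedModule ℤ⁰ i := IsLocalization.tensorProduct_isLocalizedModule ℤ⁰ ℚ
  have hcard : #(ℚ ⊗[ℤ] A) ≤ 𝔠 := by
    refine (mk_le_of_surjective (IsLocalizedModule.mk'_surjective ℤ⁰ i)).trans ?_
    simp only [mk_prod, lift_uzero]
    exact mul_le_of_le aleph0_le_continuum hA
      ((lift_le_aleph0.2 mk_le_aleph0).trans aleph0_le_continuum)
  obtain ⟨g, hg⟩ : ∃ g : ℚ ⊗[ℤ] A →ₗ[ℚ] ℝ, Function.Injective g := by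
    have b := Module.Free.chooseBasis ℚ ℝ
    refine Module.Free.exists_linearMap_injective_of_linearIndependent_of_lift_rank_le
      b.linearIndependent ?_
    rw [b.mk_eq_rank'', Real.rank_rat_real, lift_continuum, lift_le_continuum]
    exact (rank_le_card _ _).trans hcard
  refine ⟨g.toAddMonoidHom.comp i.toAddMonoidHom, fun x hx => ?_⟩
  obtain ⟨n, hn⟩ := (IsLocalizedModule.eq_zero_iff ℤ⁰ i).1 (hg (hx.trans (map_zero g).symm))
  refine ⟨(n : ℤ).natAbs, Int.natAbs_ne_zero.2 (nonZeroDivisors.coe_ne_zero n), ?_⟩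
  rcases Int.natAbs_eq (n : ℤ) with h | h
  · rw [← natCast_zsmul, ← h]; exact hn
  · rw [← natCast_zsmul, ← neg_eq_zero, ← neg_smul, ← h]; exact hn

theorem exists_injective_linearMap_fun_zmod (p : ℕ) [Fact p.Prime] (V : Type*) [AddCommGroup V]
    [Module (ZMod p) V] (hV : #V ≤ 𝔠) :
    ∃ g : V →ₗ[ZMod p] (ℕ → ZMod p), Function.Injective g := by
  have hrank : Module.rank (ZMod p) (ℕ → ZMod p) = 𝔠 := by
    rw [rank_fun_infinite, ← power_def, mk_fintype, ZMod.card, mk_nat]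
    exact nat_power_aleph0 (Fact.out : p.Prime).two_le
  have b := Module.Free.chooseBasis (ZMod p) (ℕ → ZMod p)
  refine Module.Free.exists_linearMap_injective_of_linearIndependent_of_lift_rank_le
    b.linearIndependent ?_
  rw [b.mk_eq_rank'', hrank, lift_continuum, lift_le_continuum]
  exact (rank_le_card _ _).trans hV

/-- The `p`-torsion is a vector space over `ZMod p`, so it embeds in `(ZMod p)^ℕ` and thence in
`𝕋^ℕ`; divisibility of `𝕋^ℕ` extends the map to `A`. -/
theorem exists_addMonoidHom_addCircle_of_card_le (A : Type*) [AddCommGroup A] (hA : #A ≤ 𝔠)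
    (p : ℕ) [Fact p.Prime] :
    ∃ f : A →+ (ℕ → UnitAddCircle), ∀ x, p • x = 0 → f x = 0 → x = 0 := by
  let V : AddSubgroup A := (nsmulAddMonoidHom p : A →+ A).ker
  let : Module (ZMod p) V := AddCommGroup.zmodModule fun x => Subtype.ext x.2
  obtain ⟨g, hg⟩ := exists_injective_linearMap_fun_zmod p V ((mk_subtype_le _).trans hA)
  let h : V →+ (ℕ → UnitAddCircle) :=
    (AddMonoidHom.compLeft (ZMod.toAddCircle (N := p)) ℕ).comp g.toAddMonoidHom
  have hinj : Function.Injective h :=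
    ((ZMod.toAddCircle_injective p).comp_left).comp hg
  have hB : Module.Baer ℤ (ℕ → UnitAddCircle) := by
    refine .of_smul_surjective _ fun n hn a => ?_
    refine ⟨fun k => DivisibleBy.div (a k) n, funext fun k => DivisibleBy.div_cancel (a k) hn⟩
  obtain ⟨f, hf⟩ := hB.extension_property_addMonoidHom V.subtype V.subtype_injective h
  refine ⟨f, fun x hx hfx => ?_⟩
  have : h ⟨x, hx⟩ = 0 := (DFunLike.congr_fun hf ⟨x, hx⟩).symm.trans hfx
  exact congrArg Subtype.val (hinj (this.trans (map_zero h).symm))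

/-- An abelian group of cardinality at most continuum embeds into a fixed Polish group. -/
theorem exists_injective_addMonoidHom_of_card_le (A : Type*) [AddCommGroup A] (hA : #A ≤ 𝔠) :
    ∃ f : A →+ ℝ × (Nat.Primes → ℕ → UnitAddCircle), Function.Injective f := by
  obtain ⟨r, hr⟩ := exists_addMonoidHom_real_of_card_le A hA
  have (p : Nat.Primes) : ∃ f : A →+ (ℕ → UnitAddCircle), ∀ x, (p : ℕ) • x = 0 → f x = 0 → x = 0 :=
    have : Fact (p : ℕ).Prime := ⟨p.2⟩
    exists_addMonoidHom_addCircle_of_card_le A hA p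
  choose c hc using this
  refine ⟨r.prod (AddMonoidHom.mk' (fun x p => c p x) fun a b => by ext; simp), ?_⟩
  refine (injective_iff_map_eq_zero _).2 fun x hx => ?_
  obtain ⟨h1, h2⟩ := Prod.ext_iff.1 hx
  obtain ⟨n, hn, hnx⟩ := hr x h1
  by_contra hx0
  have hfin : IsOfFinAddOrder x := isOfFinAddOrder_iff_nsmul_eq_zero.2 ⟨n, Nat.pos_of_ne_zero hn, hnx⟩
  -- A nonzero torsion `x` has a multiple `k • x` of prime order `p`, on which `c p` is injective.
  obtain ⟨p, hp, k, hk⟩ := Nat.exists_prime_and_dvd (mt AddMonoid.addOrderOf_eq_one_iff.1 hx0)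
  have hk0 : k • x = 0 := by
    refine hc ⟨p, hp⟩ _ ?_ ?_
    · change p • k • x = 0
      rw [smul_smul, ← hk, addOrderOf_nsmul_eq_zero]
    · rw [map_nsmul, show c ⟨p, hp⟩ x = 0 from congrFun h2 _, smul_zero]
  have hpos := hfin.addOrderOf_pos
  have hkpos : 0 < k := Nat.pos_of_ne_zero (by rintro rfl; simp [hk] at hpos)
  have := Nat.le_of_dvd hkpos (addOrderOf_dvd_of_nsmul_eq_zero hk0)
  rw [hk] at this
  nlinarith [hp.two_le]

theorem exists_isEmbedding_divisible (H : Type u) [AddCommGroup H] [τ : TopologicalSpace H]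
    [IsTopologicalAddGroup H] [MetrizableSpace H] [SeparableSpace H] :
    ∃ (D : Type u) (_ : NormedAddCommGroup D) (f : H →+ D),
      SeparableSpace D ∧ Module.Baer ℤ D ∧ IsEmbedding f := by
  obtain ⟨N, rfl⟩ := exists_addGroupNorm_of_metrizable H
  let := N.toNormedAddCommGroup
  obtain ⟨D, hD, f, hsep, hdiv, hf⟩ := exists_isometry_divisible H
  exact ⟨D, hD, f, hsep, hdiv, hf.isEmbedding⟩

theorem corollary3 {G : Type*} [AddCommGroup G] (H : AddSubgroup G)
    (hG : Cardinal.mk G ≤ Cardinal.continuum)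
    (τH : TopologicalSpace H)
    (hgrp : @IsTopologicalAddGroup H τH _)
    (hmet : @TopologicalSpace.MetrizableSpace H τH)
    (hsep : @TopologicalSpace.SeparableSpace H τH) :
    ∃ τG : TopologicalSpace G,
      @IsTopologicalAddGroup G τG _ ∧
      @TopologicalSpace.MetrizableSpace G τG ∧
      @TopologicalSpace.SeparableSpace G τG ∧
      TopologicalSpace.induced (Subtype.val : H → G) τG = τH := by
  obtain ⟨D, _, f, _, hdiv, hf⟩ := exists_isEmbedding_divisible H
  obtain ⟨F, hF⟩ := hdiv.extension_property_addMonoidHom H.subtype H.subtype_injective f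
  have hFH (x : H) : F x = f x := DFunLike.congr_fun hF x
  obtain ⟨q, hq⟩ := exists_injective_addMonoidHom_of_card_le (G ⧸ H)
    ((mk_le_of_surjective (QuotientAddGroup.mk_surjective (s := H))).trans hG)
  let Φ : G →+ D × (ℝ × (Nat.Primes → ℕ → UnitAddCircle)) :=
    F.prod (q.comp (QuotientAddGroup.mk' H))
  have hΦH (x : H) : Φ x = (f x, 0) := by
    simp [Φ, hFH, (QuotientAddGroup.eq_zero_iff (x : G)).2 x.2]
  have hΦ : Function.Injective Φ := by
    refine (injective_iff_map_eq_zero _).2 fun x hx => ?_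
    obtain ⟨h1, h2⟩ := Prod.ext_iff.1 hx
    have hxH : x ∈ H := (QuotientAddGroup.eq_zero_iff x).1 (hq (h2.trans (map_zero q).symm))
    have h3 : f ⟨x, hxH⟩ = 0 := (hFH ⟨x, hxH⟩).symm.trans h1
    exact congrArg Subtype.val (hf.injective (h3.trans (map_zero f).symm))
  let τG : TopologicalSpace G := .induced Φ inferInstance
  have hemb : IsEmbedding Φ := ⟨⟨rfl⟩, hΦ⟩
  have : SecondCountableTopology D := UniformSpace.secondCountable_of_separable D
  have : SecondCountableTopology G := hemb.secondCountableTopology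
  refine ⟨τG, topologicalAddGroup_induced Φ, hemb.metrizableSpace, inferInstance, ?_⟩
  rw [induced_compose, hf.eq_induced]
  have hcomp : Φ ∘ (Subtype.val : H → G) = (fun d : D => (d, 0)) ∘ f := funext hΦH
  rw [hcomp, ← induced_compose, ← (isEmbedding_prodMkLeft _).eq_induced]
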